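/- Let $\kappa$ be a regular cardinal and let $\mathsf A$ be a $\kappa$-accessible category: $\mathsf A$ has $\kappa$-directed colimits, and there is a set of $\kappa$-presentable objects of $\mathsf A$ such that every object of $\mathsf A$ is a $\kappa$-directed colimit of objects from this set. Let $\mathsf A_{<\kappa}\subset\mathsf A$ be the full subcategory of all $\kappa$-presentable objects. A class $\mathcal M$ of morphisms in a category $\mathsf C$ is called a *QE-mono class* in $\mathsf C$ if (i) for all morphisms $m\colon C\to D$ from $\mathcal M$ and $f\colon C\to C'$ in $\mathsf C$, the pushout $D'$ of $m$ and $f$ exists in $\mathsf C$, and the resulting morphism $m'\colon C'\to D'$ belongs to $\mathcal M$; (ii) every morphism $m\colon C\to D$ from $\mathcal M$ is the equalizer of its cokernel pair $k_1,k_2\colon D\rightrightarrows K$ (the pushout of $m$ with itself, which exists by (i)); (iii) all identity morphisms of $\mathsf C$ belong to $\mathcal M$, and $\mathcal M$ is closed under composition. Given a QE-mono class $\mathcal M$ in $\mathsf C$, an *$\mathcal M$-sequence* is a diagram $C\xrightarrow{m}D\overset{k_1}{\underset{k_2}{\rightrightarrows}}K$ in $\mathsf C$ with $m\in\mathcal M$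 and $(k_1,k_2)$ a cokernel pair of $m$. It is viewed as an object of the category $\mathsf C^J$ of $J$-shaped diagrams in $\mathsf C$, where $J$ is the category with three objects $1,2,3$ and four nonidentity morphisms $1\to2$, $2\rightrightarrows3$, $1\to3$ (both the compositions $1\to2\rightrightarrows3$ being equal to $1\to3$). A QE-mono class $\mathcal M$ in the $\kappa$-accessible category $\mathsf A$ is called *locally $\kappa$-coherent* if the $\mathcal M$-sequences in $\mathsf A$ are precisely all the $\kappa$-directed colimits, taken in $\mathsf A^J$, of $\mathcal M$-sequences in $\mathsf A$ with all three terms $C,D,K$ belonging to $\mathsf A_{<\kappa}$. **Theorem.** Let $\mathcal N$ be a QE-mono class in the category $\mathsf A_{<\kappa}$. Then the class $\varinjlim_{(\kappa)}\mathcal N$ of all $\kappa$-directed colimits of morphisms from $\mathcal N$, the colimits being taken in the category of morphisms $\mathsf A^\to$ of $\mathsf A$, is a locally $\kappa$-coherent QE-mono class in $\mathsf A$. -/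

import Mathlib

universe w v u

open CategoryTheory CategoryTheory.Limits

namespace QEMono

section

variable {C : Type u} [Category.{v} C]

/-- A class `M` of morphisms of a category is a *QE-mono class* if all pushouts of morphisms
from `M` exist and again belong to `M`, every morphism from `M` is the equalizer of its cokernel
pair (the pushout of the morphism along itself), and `M` contains all identity morphisms and is
closed under composition. -/
structure IsQEMonoClass (M : MorphismProperty C) : Prop where
  hasPushout {X Y X' : C} (m : X ⟶ Y) (f : X ⟶ X') (hm : M m) : HasPushout m f
  of_isPushout {X Y X' Y' : C} {m : X ⟶ Y} {f : X ⟶ X'} {m' : X' ⟶ Y'} {f' : Y ⟶ Y'}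
    (sq : IsPushout m f f' m') (hm : M m) : M m'
  isEqualizer {X Y K : C} {m : X ⟶ Y} {k₁ k₂ : Y ⟶ K} (hm : M m) (sq : IsPushout m m k₁ k₂) :
    Nonempty (IsLimit (Fork.ofι m sq.w))
  id_mem (X : C) : M (𝟙 X)
  comp_mem {X Y Z : C} (f : X ⟶ Y) (g : Y ⟶ Z) (hf : M f) (hg : M g) : M (f ≫ g)

/-- The objects of `C` that are colimits (in `C`) of diagrams of objects satisfying `P` indexed by
small `κ`-directed posets. A poset, regarded as a category, is `κ`-filtered if and only
if it is `κ`-directed, that is, every subset of cardinality `< κ` has an upper bound. -/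
def directedColimits (κ : Cardinal.{w}) [Fact κ.IsRegular] (P : ObjectProperty C) :
    ObjectProperty C := fun X ↦
  ∃ (Ξ : Type w) (_ : PartialOrder Ξ) (_ : IsCardinalFiltered Ξ κ), P.colimitsOfShape Ξ X

/-- The shape `1 ⟶ 2 ⇉ 3` of a fork: three objects `1`, `2`, `3`, and four
nonidentity morphisms `1 ⟶ 2`, `2 ⇉ 3`, and `1 ⟶ 3`, the latter one being equal to both composites
`1 ⟶ 2 ⇉ 3`. It is the parallel pair `2 ⇉ 3` with an initial object `1` freely adjoined. -/
abbrev ForkShape : Type := WithInitial WalkingParallelPair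

namespace ForkShape

/-- The object `1` of `1 ⟶ 2 ⇉ 3`. -/
abbrev one : ForkShape := WithInitial.star

/-- The object `2` of `1 ⟶ 2 ⇉ 3`. -/
abbrev two : ForkShape := WithInitial.of WalkingParallelPair.zero

/-- The object `3` of `1 ⟶ 2 ⇉ 3`. -/
abbrev three : ForkShape := WithInitial.of WalkingParallelPair.one

/-- The morphism `1 ⟶ 2`. -/
abbrev m : one ⟶ two := WithInitial.homTo WalkingParallelPair.zero

/-- The first morphism `2 ⟶ 3`. -/
abbrev k₁ : two ⟶ three := WithInitial.incl.map WalkingParallelPairHom.left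

/-- The second morphism `2 ⟶ 3`. -/
abbrev k₂ : two ⟶ three := WithInitial.incl.map WalkingParallelPairHom.right

end ForkShape

/-- The `M`-sequences: the diagrams `C ⟶ D ⇉ K` in which the morphism `C ⟶ D` belongs to `M`
and the pair of morphisms `D ⇉ K` is its cokernel pair. -/
def mSequences (M : MorphismProperty C) : ObjectProperty (ForkShape ⥤ C) := fun S ↦
  M (S.map ForkShape.m) ∧
    IsPushout (S.map ForkShape.m) (S.map ForkShape.m) (S.map ForkShape.k₁) (S.map ForkShape.k₂)

end

section

variable {A : Type u} [Category.{v} A] (κ : Cardinal.{w}) [Fact κ.IsRegular]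

/-- A class `M` of morphisms is *locally `κ`-coherent* if the `M`-sequences are precisely all the
`κ`-directed colimits, in the category of diagrams, of `M`-sequences with all the three
terms `κ`-presentable. (It is applied to QE-mono classes in `κ`-accessible categories.) -/
def IsLocallyCoherent (M : MorphismProperty A) : Prop :=
  ∀ S : ForkShape ⥤ A, mSequences M S ↔
    directedColimits κ (fun T : ForkShape ⥤ A ↦
      mSequences M T ∧ ∀ i : ForkShape, IsCardinalPresentable (T.obj i) κ) S

variable (A) in
/-- The full subcategory of `κ`-presentable objects. -/
abbrev Presentables : Type u := (isCardinalPresentable A κ).FullSubcategory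

/-- A class `N` of morphisms in the full subcategory of `κ`-presentable objects, regarded as a
class of objects in the category of morphisms of `A`. -/
def arrowsOf (N : MorphismProperty (Presentables A κ)) : ObjectProperty (Arrow A) := fun a ↦
  ∃ (hl : isCardinalPresentable A κ a.left) (hr : isCardinalPresentable A κ a.right),
    N (ObjectProperty.homMk a.hom : (⟨a.left, hl⟩ : Presentables A κ) ⟶ ⟨a.right, hr⟩)

/-- The class of all `κ`-directed colimits of morphisms from `N`, the colimits being taken in the
category of morphisms of `A`. -/
def directedColimitClosure (N : MorphismProperty (Presentables A κ)) : MorphismProperty A :=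
  fun _ _ f ↦ directedColimits κ (arrowsOf κ N) (Arrow.mk f)

end

end QEMono

/-! The closure of `N` coincides with the class `factoring N`, which makes no reference to a chosen
diagram (`directedColimitClosure_iff_factoring`). A `κ`-directed colimit of members of `N` has the
factoring property because a square from a morphism of `κ`-presentable objects already lives at some
stage. Conversely, `X` and `Y` are canonical colimits of the `κ`-presentable objects over them; for
`f : X ⟶ Y` the squares into `f` form a `κ`-filtered comma category, and factoring says exactly that
the squares starting in `N` are cofinal in it.

Composites are then handled by interleaving factorizations and taking one pushout in the presentable
objects (`factoring_comp`). Pushouts and cokernel pairs are formed stagewise among presentable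
objects and passed to the colimit, since the inclusion preserves pushouts (`isPushout_hom`) and
colimits commute with pushouts (`isPushout_of_isColimit`). The equalizer property is tested on
presentable objects, where it reduces to that of `N` at one stage. The same stagewise cokernel pairs
(`exists_cokernelPair_presentation`) give local coherence. -/

namespace QEMono

/-! ### Size and filteredness of comma categories -/

section Comma

universe v₁ v₂ v₃ u₁ u₂ u₃

variable {C : Type u₁} [Category.{v₁} C] {D : Type u₂} [Category.{v₂} D]
  {T : Type u₃} [Category.{v₃} T]

lemma locallySmall_comma (L : C ⥤ T) (R : D ⥤ T) [LocallySmall.{w} C] [LocallySmall.{w} D] :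
    LocallySmall.{w} (Comma L R) where
  hom_small X Y :=
    small_of_injective (f := fun g : X ⟶ Y ↦ ((g.left, g.right) :
      (X.left ⟶ Y.left) × (X.right ⟶ Y.right))) (fun g h e ↦ by
        simp only [Prod.mk.injEq] at e
        exact CommaMorphism.ext e.1 e.2)

/-- Needed so that the category of squares into a morphism may serve as an index category. -/
lemma essentiallySmall_comma (L : C ⥤ T) (R : D ⥤ T)
    [EssentiallySmall.{w} C] [EssentiallySmall.{w} D] [LocallySmall.{w} T] :
    EssentiallySmall.{w} (Comma L R) := by
  let eC := (equivSmallModel.{w} C).inverse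
  let eD := (equivSmallModel.{w} D).inverse
  have h₁ : Small.{w} (Comma (eC ⋙ L) (eD ⋙ R)) :=
    small_of_injective (β := Σ (c : SmallModel.{w} C) (d : SmallModel.{w} D),
        (L.obj (eC.obj c) ⟶ R.obj (eD.obj d)))
      (f := fun X ↦ ⟨X.left, X.right, X.hom⟩) (by
        rintro ⟨a, b, f⟩ ⟨a', b', f'⟩ h
        simp only [Sigma.mk.injEq] at h
        obtain ⟨rfl, h⟩ := h
        simp only [heq_eq_eq, Sigma.mk.injEq] at h
        obtain ⟨rfl, h⟩ := h
        simp only [heq_eq_eq] at h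
        subst h
        rfl)
  have h₂ := locallySmall_comma.{w} (eC ⋙ L) (eD ⋙ R)
  have h₃ : EssentiallySmall.{w} (Comma (eC ⋙ L) (eD ⋙ R)) :=
    essentiallySmall_of_small_of_locallySmall _
  have h₄ : EssentiallySmall.{w} (Comma L (eD ⋙ R)) :=
    (essentiallySmall_congr (Comma.preLeft eC L (eD ⋙ R)).asEquivalence).1 h₃
  exact (essentiallySmall_congr (Comma.preRight L eD R).asEquivalence).1 h₄

variable (κ : Cardinal.{w}) [Fact κ.IsRegular]

open IsCardinalFiltered in
lemma isCardinalFiltered_comma_id (L : C ⥤ D) [IsCardinalFiltered C κ] [IsCardinalFiltered D κ] :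
    IsCardinalFiltered (Comma L (𝟭 D)) κ where
  nonempty_cocone {A _} F hA := by
    have := isFiltered_of_isCardinalFiltered D κ
    let c₁ := cocone (F ⋙ Comma.fst _ _) hA
    let c₂ := cocone (F ⋙ Comma.snd _ _) hA
    let a := IsFiltered.leftToMax (L.obj c₁.pt) c₂.pt
    let b := IsFiltered.rightToMax (L.obj c₁.pt) c₂.pt
    -- Bounding the two components separately leaves fewer than `κ` squares that need not commute;
    -- one morphism `g` corrects all of them at once.
    obtain ⟨d, g, hg⟩ := IsCardinalFiltered.multicoequalizer (κ := κ)
      (fun i : A ↦ L.map (c₁.ι.app i) ≫ a) (fun i ↦ (F.obj i).hom ≫ c₂.ι.app i ≫ b)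
      (hasCardinalLT_of_hasCardinalLT_arrow hA)
    simp only [Category.assoc] at hg
    refine ⟨{
      pt := ⟨c₁.pt, d, a ≫ g⟩
      ι := {
        app i := ⟨c₁.ι.app i, c₂.ι.app i ≫ b ≫ g, ?_⟩
        naturality i j f := ?_ } }⟩
    · exact hg i
    · apply CommaMorphism.ext
      · exact c₁.ι.naturality f
      · have := c₂.w f
        simp only [Functor.comp_map, Comma.snd_map] at this
        simp [reassoc_of% this]

lemma isCardinalFiltered_fullSubcategory [IsCardinalFiltered C κ] (P : ObjectProperty C)
    (hP : ∀ X : C, ∃ (Y : C) (_ : X ⟶ Y), P Y) :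
    IsCardinalFiltered P.FullSubcategory κ where
  nonempty_cocone {A _} F hA := by
    let c := IsCardinalFiltered.cocone (F ⋙ P.ι) hA
    obtain ⟨Y, f, hY⟩ := hP c.pt
    exact ⟨{
      pt := ⟨Y, hY⟩
      ι := {
        app i := ObjectProperty.homMk (c.ι.app i ≫ f)
        naturality i j g := by
          ext
          have := c.w g
          simp only [Functor.comp_map, ObjectProperty.ι_map] at this
          simp [reassoc_of% this] } }⟩

lemma final_fullSubcategory_ι [IsFiltered C] (P : ObjectProperty C)
    (hP : ∀ X : C, ∃ (Y : C) (_ : X ⟶ Y), P Y) : P.ι.Final :=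
  Functor.final_of_exists_of_isFiltered_of_fullyFaithful _ (fun X ↦ by
    obtain ⟨Y, f, hY⟩ := hP X
    exact ⟨⟨Y, hY⟩, ⟨f⟩⟩)

end Comma

/-! ### From filtered categories to directed posets -/

section DirectedColimits

variable {C : Type u} [Category.{v} C] {κ : Cardinal.{w}} [Fact κ.IsRegular]

/-- Every small `κ`-filtered category receives a final functor from a `κ`-directed poset. -/
lemma directedColimits_of_colimitsOfShape {P : ObjectProperty C} {X : C}
    {J : Type*} [Category* J] [EssentiallySmall.{w} J] [IsCardinalFiltered J κ]
    (h : P.colimitsOfShape J X) : directedColimits κ P X := by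
  have := IsCardinalFiltered.of_equivalence κ (equivSmallModel.{w} J)
  obtain ⟨Ξ, _, _, F, _⟩ := IsCardinalFiltered.exists_cardinal_directed (SmallModel.{w} J) κ
  exact ⟨Ξ, inferInstance, inferInstance,
    P.colimitsOfShape_le_of_final (F ⋙ (equivSmallModel.{w} J).inverse) _ h⟩

end DirectedColimits

/-! ### The factoring property -/

section Factorization

variable {A : Type u} [Category.{v} A] {κ : Cardinal.{w}} [Fact κ.IsRegular]

/-- The morphisms `f` such that any morphism to `f` from a morphism between `κ`-presentable objects
factors through a morphism from `N`. -/
def factoring (N : MorphismProperty (Presentables A κ)) : MorphismProperty A := fun X Y f ↦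
  ∀ ⦃P Q : Presentables A κ⦄ (p : P ⟶ Q) (a : P.obj ⟶ X) (b : Q.obj ⟶ Y),
    a ≫ f = p.hom ≫ b → ∃ (P' Q' : Presentables A κ) (n : P' ⟶ Q') (s : P ⟶ P') (t : Q ⟶ Q')
      (a' : P'.obj ⟶ X) (b' : Q'.obj ⟶ Y), N n ∧ s ≫ n = p ≫ t ∧ s.hom ≫ a' = a ∧
        t.hom ≫ b' = b ∧ a' ≫ f = n.hom ≫ b'

variable {N : MorphismProperty (Presentables A κ)}

lemma factoring_hom {P Q : Presentables A κ} {n : P ⟶ Q} (hn : N n) : factoring N n.hom := by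
  intro P' Q' p a b h
  exact ⟨P, Q, n, ObjectProperty.homMk a, ObjectProperty.homMk b, 𝟙 _, 𝟙 _, hn,
    by ext; exact h, Category.comp_id _, Category.comp_id _, by simp⟩

lemma factoring_of_iso {X Y X' Y' : A} {f : X ⟶ Y} (hf : factoring N f) {f' : X' ⟶ Y'}
    (e : X ≅ X') (e' : Y ≅ Y') (h : f ≫ e'.hom = e.hom ≫ f') : factoring N f' := by
  intro P Q p a b hab
  obtain ⟨P', Q', n, s, t, a', b', hn, h₁, h₂, h₃, h₄⟩ := hf p (a ≫ e.inv) (b ≫ e'.inv) (by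
    rw [← reassoc_of% hab, ← cancel_mono e'.hom]
    simp [h])
  refine ⟨P', Q', n, s, t, a' ≫ e.hom, b' ≫ e'.hom, hn, h₁, ?_, ?_, ?_⟩
  · simp [reassoc_of% h₂]
  · simp [reassoc_of% h₃]
  · rw [Category.assoc, ← h, reassoc_of% h₄]

lemma factoring_of_isColimit {J : Type*} [Category* J] [EssentiallySmall.{w} J]
    [IsCardinalFiltered J κ] {F G : J ⥤ A} (φ : F ⟶ G) {cF : Cocone F} {cG : Cocone G}
    (hF : IsColimit cF) (hG : IsColimit cG) {f : cF.pt ⟶ cG.pt}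
    (hf : ∀ j, cF.ι.app j ≫ f = φ.app j ≫ cG.ι.app j) (h : ∀ j, factoring N (φ.app j)) :
    factoring N f := by
  intro P Q p a b hab
  have := isFiltered_of_isCardinalFiltered J κ
  obtain ⟨i, a, rfl⟩ := IsCardinalPresentable.exists_hom_of_isColimit κ hF a
  obtain ⟨j, b, rfl⟩ := IsCardinalPresentable.exists_hom_of_isColimit κ hG b
  -- The two sides of the square lift to stages `i` and `j`; they agree only from a common later
  -- stage `k` on.
  obtain ⟨k, u, v, huv⟩ := IsCardinalPresentable.exists_eq_of_isColimit κ hG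
    (a ≫ φ.app i) (p.hom ≫ b) (by simpa [hf] using hab)
  obtain ⟨P', Q', n, s, t, a', b', hn, h₁, h₂, h₃, h₄⟩ := h k p (a ≫ F.map u) (b ≫ G.map v)
    (by simpa using huv)
  refine ⟨P', Q', n, s, t, a' ≫ cF.ι.app k, b' ≫ cG.ι.app k, hn, h₁, ?_, ?_, ?_⟩
  · simp [reassoc_of% h₂]
  · simp [reassoc_of% h₃]
  · simp [hf, reassoc_of% h₄]

end Factorization

/-! ### Canonical diagrams, and closure versus factoring -/

section Canonical

variable {A : Type u} [Category.{v} A] (κ : Cardinal.{w}) [Fact κ.IsRegular]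

/-- The category of `κ`-presentable objects over `X`. -/
abbrev PresentableOver (X : A) := CostructuredArrow (isCardinalPresentable A κ).ι X

/-- The tautological cocone expressing `X` in terms of the `κ`-presentable objects over `X`. -/
@[simps]
def canonicalCocone (X : A) :
    Cocone (CostructuredArrow.proj (isCardinalPresentable A κ).ι X ⋙
      (isCardinalPresentable A κ).ι) where
  pt := X
  ι :=
    { app g := g.hom
      naturality _ _ φ := (CostructuredArrow.w φ).trans (Category.comp_id _).symm }

variable [IsCardinalAccessibleCategory A κ]

/-- Any object of a `κ`-accessible category is the colimit of the `κ`-presentable objects over it.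
-/
noncomputable def isColimitCanonicalCocone (X : A) : IsColimit (canonicalCocone κ X) :=
  IsColimit.ofIsoColimit ((isCardinalPresentable A κ).ι.denseAt X)
    (Cocone.ext (Iso.refl _) (fun _ ↦
      (Category.comp_id _).trans (Category.id_comp _)))

variable {κ} {N : MorphismProperty (Presentables A κ)}

lemma directedColimitClosure_of_factoring {X Y : A} {f : X ⟶ Y} (hf : factoring N f) :
    directedColimitClosure κ N f := by
  -- An object of `Comma L (𝟭 _)` is a square into `f` from a morphism of presentable objects; `P`
  -- selects those whose morphism is in `N`, and `hP` is their cofinality.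
  let L : PresentableOver κ X ⥤ PresentableOver κ Y := CostructuredArrow.map f
  let P : ObjectProperty (Comma L (𝟭 (PresentableOver κ Y))) := fun w ↦
    N (show w.left.left ⟶ w.right.left from w.hom.left)
  have hP (w : Comma L (𝟭 (PresentableOver κ Y))) : ∃ (w' : _) (_ : w ⟶ w'), P w' := by
    obtain ⟨P', Q', n, s, t, a', b', hn, h₁, h₂, h₃, h₄⟩ :=
      hf (show w.left.left ⟶ w.right.left from w.hom.left) w.left.hom w.right.hom
        (CostructuredArrow.w w.hom).symm
    refine ⟨{ left := CostructuredArrow.mk (S := (isCardinalPresentable A κ).ι) a'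
              right := CostructuredArrow.mk (S := (isCardinalPresentable A κ).ι) b'
              hom := CostructuredArrow.homMk n h₄.symm },
            { left := CostructuredArrow.homMk s h₂
              right := CostructuredArrow.homMk t h₃
              w := ?_ }, hn⟩
    apply CostructuredArrow.hom_ext
    exact h₁
  have : EssentiallySmall.{w} (Comma L (𝟭 (PresentableOver κ Y))) := essentiallySmall_comma _ _
  have : ObjectProperty.EssentiallySmall.{w} P := .of_le (Q := ⊤) le_top
  have : EssentiallySmall.{w} P.FullSubcategory := inferInstance
  have := isFiltered_of_isCardinalFiltered (PresentableOver κ X) κ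
  have := isFiltered_of_isCardinalFiltered (PresentableOver κ Y) κ
  have := isCardinalFiltered_comma_id κ L
  have := isCardinalFiltered_fullSubcategory κ P hP
  have := final_fullSubcategory_ι P hP
  let D : P.FullSubcategory ⥤ Arrow A :=
    { obj w := Arrow.mk (show w.obj.left.left ⟶ w.obj.right.left from w.obj.hom.left).hom
      map {w w'} g := Arrow.homMk g.hom.left.left.hom g.hom.right.left.hom
        (congr_arg (fun h ↦ h.left.hom) g.hom.w)
      map_id _ := rfl
      map_comp _ _ := rfl }
  let c : Cocone D :=
    { pt := Arrow.mk f
      ι := { app w := Arrow.homMk w.obj.left.hom w.obj.right.hom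
                (CostructuredArrow.w w.obj.hom).symm
             naturality w w' g := by
              apply Arrow.hom_ext
              · simpa using! CostructuredArrow.w g.hom.left
              · simpa using! CostructuredArrow.w g.hom.right } }
  -- Colimits of arrows are detected on sources and targets, where finality reduces to the canonical
  -- colimits of `X` and `Y`.
  have hc : IsColimit c := by
    apply Comma.fstSndJointlyReflectColimit
    · exact (Functor.Final.isColimitWhiskerEquiv (P.ι ⋙ Comma.fst _ _) _).symm
        (isColimitCanonicalCocone κ X)
    · exact (Functor.Final.isColimitWhiskerEquiv (P.ι ⋙ Comma.snd _ _) _).symm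
        (isColimitCanonicalCocone κ Y)
  exact directedColimits_of_colimitsOfShape (J := P.FullSubcategory) ⟨{
    diag := D
    ι := c.ι
    isColimit := hc
    prop_diag_obj w := ⟨w.obj.left.left.property, w.obj.right.left.property, w.property⟩ }⟩

/-- A morphism in the closure is a `κ`-directed colimit of morphisms from `N`. -/
lemma exists_presentation {X Y : A} {f : X ⟶ Y} (hf : directedColimitClosure κ N f) :
    ∃ (Ξ : Type w) (_ : PartialOrder Ξ) (_ : IsCardinalFiltered Ξ κ)
      (F G : Ξ ⥤ Presentables A κ) (φ : F ⟶ G)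
      (a : F ⋙ (isCardinalPresentable A κ).ι ⟶ (Functor.const Ξ).obj X)
      (b : G ⋙ (isCardinalPresentable A κ).ι ⟶ (Functor.const Ξ).obj Y)
      (_ : IsColimit (Cocone.mk X a)) (_ : IsColimit (Cocone.mk Y b)),
      (∀ j, a.app j ≫ f = (φ.app j).hom ≫ b.app j) ∧ ∀ j, N (φ.app j) := by
  obtain ⟨Ξ, _, _, ⟨p⟩⟩ := hf
  have := HasCardinalFilteredColimits.hasColimitsOfShape A κ Ξ
  exact ⟨Ξ, inferInstance, inferInstance,
    ObjectProperty.lift _ (p.diag ⋙ Arrow.leftFunc) (fun j ↦ (p.prop_diag_obj j).choose),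
    ObjectProperty.lift _ (p.diag ⋙ Arrow.rightFunc)
      (fun j ↦ (p.prop_diag_obj j).choose_spec.choose),
    { app j := ObjectProperty.homMk (p.diag.obj j).hom
      naturality j j' g := ObjectProperty.hom_ext _ (p.diag.map g).w },
    (Arrow.leftFunc.mapCocone p.cocone).ι, (Arrow.rightFunc.mapCocone p.cocone).ι,
    isColimitOfPreserves Arrow.leftFunc p.isColimit,
    isColimitOfPreserves Arrow.rightFunc p.isColimit, fun j ↦ (p.ι.app j).w,
    fun j ↦ (p.prop_diag_obj j).choose_spec.choose_spec⟩

lemma directedColimitClosure_iff_factoring {X Y : A} (f : X ⟶ Y) :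
    directedColimitClosure κ N f ↔ factoring N f := by
  refine ⟨fun hf ↦ ?_, directedColimitClosure_of_factoring⟩
  obtain ⟨Ξ, _, _, F, G, φ, a, b, hF, hG, h₁, h₂⟩ := exists_presentation hf
  exact factoring_of_isColimit (Functor.whiskerRight φ (isCardinalPresentable A κ).ι) hF hG
    h₁ (fun j ↦ factoring_hom (h₂ j))

lemma directedColimitClosure_eq_factoring :
    directedColimitClosure κ N = factoring N := by
  ext X Y f
  exact directedColimitClosure_iff_factoring f

end Canonical

/-! ### Pushouts in functor categories and their colimits -/

section Pushouts

universe v₁ u₁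

variable {C : Type u} [Category.{v} C] {J : Type u₁} [Category.{v₁} J]

lemma isPushout_of_exists {X Y X' Y' : C} {m : X ⟶ Y} {f : X ⟶ X'} {f' : Y ⟶ Y'} {m' : X' ⟶ Y'}
    (w : m ≫ f' = f ≫ m')
    (hom_ext : ∀ ⦃T : C⦄ (s t : Y' ⟶ T), f' ≫ s = f' ≫ t → m' ≫ s = m' ≫ t → s = t)
    (desc : ∀ ⦃T : C⦄ (s : Y ⟶ T) (t : X' ⟶ T), m ≫ s = f ≫ t →
      ∃ l : Y' ⟶ T, f' ≫ l = s ∧ m' ≫ l = t) : IsPushout m f f' m' :=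
  ⟨⟨w⟩, ⟨PushoutCocone.IsColimit.mk w (fun s ↦ (desc s.inl s.inr s.condition).choose)
    (fun s ↦ (desc s.inl s.inr s.condition).choose_spec.1)
    (fun s ↦ (desc s.inl s.inr s.condition).choose_spec.2)
    (fun s _ h₁ h₂ ↦ hom_ext _ _
      (h₁.trans (desc s.inl s.inr s.condition).choose_spec.1.symm)
      (h₂.trans (desc s.inl s.inr s.condition).choose_spec.2.symm))⟩⟩

lemma isPushout_of_isColimit {F G H K : J ⥤ C} {α : F ⟶ G} {β : F ⟶ H} {γ : G ⟶ K} {δ : H ⟶ K}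
    (sq : ∀ j, IsPushout (α.app j) (β.app j) (γ.app j) (δ.app j)) {X Y X' Y' : C}
    {x : F ⟶ (Functor.const J).obj X} {y : G ⟶ (Functor.const J).obj Y}
    {x' : H ⟶ (Functor.const J).obj X'} {y' : K ⟶ (Functor.const J).obj Y'}
    (hx : IsColimit (Cocone.mk X x)) (hy : IsColimit (Cocone.mk Y y))
    (hx' : IsColimit (Cocone.mk X' x')) (hy' : IsColimit (Cocone.mk Y' y'))
    {m : X ⟶ Y} {f : X ⟶ X'} {f' : Y ⟶ Y'} {m' : X' ⟶ Y'}
    (hm : ∀ j, x.app j ≫ m = α.app j ≫ y.app j) (hf : ∀ j, x.app j ≫ f = β.app j ≫ x'.app j)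
    (hf' : ∀ j, y.app j ≫ f' = γ.app j ≫ y'.app j)
    (hm' : ∀ j, x'.app j ≫ m' = δ.app j ≫ y'.app j) : IsPushout m f f' m' := by
  refine isPushout_of_exists (hx.hom_ext fun j ↦ ?_) (fun T s t h₁ h₂ ↦ hy'.hom_ext fun j ↦ ?_)
    (fun T s t h ↦ ?_)
  · dsimp
    rw [reassoc_of% (hm j), reassoc_of% (hf j), hf', hm', reassoc_of% (sq j).w]
  · dsimp
    apply (sq j).hom_ext
    · rw [← reassoc_of% (hf' j), h₁, reassoc_of% (hf' j)]
    · rw [← reassoc_of% (hm' j), h₂, reassoc_of% (hm' j)]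
  · have h' (j : J) : α.app j ≫ y.app j ≫ s = β.app j ≫ x'.app j ≫ t := by
      rw [← reassoc_of% (hm j), h, reassoc_of% (hf j)]
    let c : Cocone K :=
      { pt := T
        ι := { app j := (sq j).desc (y.app j ≫ s) (x'.app j ≫ t) (h' j)
               naturality i j g := by
                have hy := y.naturality g
                have hx' := x'.naturality g
                dsimp at hy hx'
                rw [Category.comp_id] at hy hx'
                apply (sq i).hom_ext
                · simp [← NatTrans.naturality_assoc, reassoc_of% hy]
                · simp [← NatTrans.naturality_assoc, reassoc_of% hx'] } }
    refine ⟨hy'.desc c, hy.hom_ext fun j ↦ ?_, hx'.hom_ext fun j ↦ ?_⟩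
    · have := hy'.fac c j
      dsimp at this ⊢
      rw [reassoc_of% (hf' j), this]
      simp [c]
    · have := hy'.fac c j
      dsimp at this ⊢
      rw [reassoc_of% (hm' j), this]
      simp [c]

/-- Objectwise pushouts in a category of functors. -/
lemma exists_isPushout_app {F G H : J ⥤ C} (α : F ⟶ G) (β : F ⟶ H)
    (h : ∀ j, HasPushout (α.app j) (β.app j)) :
    ∃ (K : J ⥤ C) (γ : G ⟶ K) (δ : H ⟶ K),
      ∀ j, IsPushout (α.app j) (β.app j) (γ.app j) (δ.app j) := by
  choose Z c d sq using fun j ↦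
    (⟨_, _, _, IsPushout.of_hasPushout (α.app j) (β.app j)⟩ :
      ∃ (Z : C) (c : G.obj j ⟶ Z) (d : H.obj j ⟶ Z), IsPushout (α.app j) (β.app j) c d)
  let K : J ⥤ C :=
    { obj := Z
      map {i j} g := (sq i).desc (G.map g ≫ c j) (H.map g ≫ d j) (by
        simp [← NatTrans.naturality_assoc, (sq j).w])
      map_id j := by apply (sq j).hom_ext <;> simp
      map_comp {i _ _} f g := by apply (sq i).hom_ext <;> simp }
  exact ⟨K, { app := c }, { app := d }, sq⟩

end Pushouts

/-! ### Presentable objects over a fixed object -/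

section Presentable

variable {A : Type u} [Category.{v} A] {κ : Cardinal.{w}} [Fact κ.IsRegular]
  [IsCardinalAccessibleCategory A κ]

lemma exists_common_factorization {X : A} {P P' : Presentables A κ} (a : P.obj ⟶ X)
    (a' : P'.obj ⟶ X) : ∃ (R : Presentables A κ) (s : P ⟶ R) (s' : P' ⟶ R) (r : R.obj ⟶ X),
      s.hom ≫ r = a ∧ s'.hom ≫ r = a' := by
  have := isFiltered_of_isCardinalFiltered (PresentableOver κ X) κ
  let x : PresentableOver κ X := CostructuredArrow.mk (S := (isCardinalPresentable A κ).ι) a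
  let x' : PresentableOver κ X := CostructuredArrow.mk (S := (isCardinalPresentable A κ).ι) a'
  exact ⟨_, (IsFiltered.leftToMax x x').left, (IsFiltered.rightToMax x x').left,
    (IsFiltered.max x x').hom, CostructuredArrow.w (IsFiltered.leftToMax x x'),
    CostructuredArrow.w (IsFiltered.rightToMax x x')⟩

lemma exists_coequalizing {X : A} {P R : Presentables A κ} (s s' : P ⟶ R) (r : R.obj ⟶ X)
    (h : s.hom ≫ r = s'.hom ≫ r) : ∃ (R' : Presentables A κ) (t : R ⟶ R') (r' : R'.obj ⟶ X),
      t.hom ≫ r' = r ∧ s ≫ t = s' ≫ t := by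
  have := isFiltered_of_isCardinalFiltered (PresentableOver κ X) κ
  let x : PresentableOver κ X :=
    CostructuredArrow.mk (S := (isCardinalPresentable A κ).ι) (s.hom ≫ r)
  let y : PresentableOver κ X := CostructuredArrow.mk (S := (isCardinalPresentable A κ).ι) r
  let f : x ⟶ y := CostructuredArrow.homMk s rfl
  let g : x ⟶ y := CostructuredArrow.homMk s' h.symm
  exact ⟨_, (IsFiltered.coeqHom f g).left, (IsFiltered.coeq f g).hom,
    CostructuredArrow.w (IsFiltered.coeqHom f g), congr_arg CommaMorphism.left (IsFiltered.coeq_condition f g)⟩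

lemma exists_commSq {X : A} {P Q Q' : Presentables A κ} (s : P ⟶ Q) (s' : P ⟶ Q')
    (q : Q.obj ⟶ X) (q' : Q'.obj ⟶ X) (h : s.hom ≫ q = s'.hom ≫ q') :
    ∃ (R : Presentables A κ) (t : Q ⟶ R) (t' : Q' ⟶ R) (r : R.obj ⟶ X),
      t.hom ≫ r = q ∧ t'.hom ≫ r = q' ∧ s ≫ t = s' ≫ t' := by
  obtain ⟨R, t, t', r, rfl, rfl⟩ := exists_common_factorization q q'
  obtain ⟨R', u, r', rfl, hu⟩ := exists_coequalizing (s ≫ t) (s' ≫ t') r (by simpa using h)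
  exact ⟨R', t ≫ u, t' ≫ u, r', by simp, by simp, by simpa using hu⟩

lemma hom_ext_of_presentable {X Y : A} {f g : X ⟶ Y}
    (h : ∀ (P : Presentables A κ) (p : P.obj ⟶ X), p ≫ f = p ≫ g) : f = g :=
  (isColimitCanonicalCocone κ X).hom_ext fun P ↦ h P.left P.hom

/-- The inclusion of the category of `κ`-presentable objects preserves pushouts. -/
lemma isPushout_hom {P Q P' Q' : Presentables A κ} {m : P ⟶ Q} {f : P ⟶ P'} {f' : Q ⟶ Q'}
    {m' : P' ⟶ Q'} (sq : IsPushout m f f' m') : IsPushout m.hom f.hom f'.hom m'.hom := by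
  refine isPushout_of_exists (congr_arg InducedCategory.Hom.hom sq.w) (fun T s t h₁ h₂ ↦ ?_)
    (fun T s t h ↦ ?_)
  -- Morphisms into `T` from presentable objects are replaced by morphisms into a presentable object
  -- over `T`, enlarged until the required equalities hold; there `sq` applies.
  · obtain ⟨R, a, b, r, rfl, rfl⟩ := exists_common_factorization s t
    obtain ⟨R₁, c, r, rfl, k₁⟩ := exists_coequalizing (f' ≫ a) (f' ≫ b) r (by simpa using h₁)
    obtain ⟨R₂, d, r, rfl, k₂⟩ := exists_coequalizing (m' ≫ a ≫ c) (m' ≫ b ≫ c) r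
      (by simpa using h₂)
    have : a ≫ c ≫ d = b ≫ c ≫ d := sq.hom_ext
      (by simpa using congr_arg (fun e ↦ e ≫ d) k₁) (by simpa using k₂)
    simpa using congr_arg (fun e ↦ e.hom ≫ r) this
  · obtain ⟨R, a, b, r, rfl, rfl, hab⟩ := exists_commSq m f s t h
    exact ⟨(sq.desc a b hab).hom ≫ r, by simp [← ObjectProperty.FullSubcategory.comp_hom_assoc],
      by simp [← ObjectProperty.FullSubcategory.comp_hom_assoc]⟩

end Presentable

/-! ### Identities, pushouts and composites -/

section Closure

variable {A : Type u} [Category.{v} A] {κ : Cardinal.{w}} [Fact κ.IsRegular]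
  {N : MorphismProperty (Presentables A κ)}

lemma factoring_id (hN : IsQEMonoClass N) (X : A) : factoring N (𝟙 X) := by
  intro P Q p a b h
  exact ⟨Q, Q, 𝟙 Q, p, 𝟙 Q, b, b, hN.id_mem Q, rfl, by simpa using h.symm, by simp, by simp⟩

lemma factoring_of_isPushout_of_isPushout {X Y X' Y₁ Y₂ : A} {m : X ⟶ Y} {f : X ⟶ X'}
    {f₁ : Y ⟶ Y₁} {m₁ : X' ⟶ Y₁} {f₂ : Y ⟶ Y₂} {m₂ : X' ⟶ Y₂}
    (sq₁ : IsPushout m f f₁ m₁) (sq₂ : IsPushout m f f₂ m₂) (h : factoring N m₁) :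
    factoring N m₂ :=
  factoring_of_iso h (Iso.refl _) (sq₁.isoIsPushout _ _ sq₂) (by simp)

lemma exists_isPushout_of_isColimit {J : Type*} [Category* J] [EssentiallySmall.{w} J]
    [IsCardinalFiltered J κ] [HasColimitsOfShape J A] {F G H : J ⥤ A} (α : F ⟶ G) (β : F ⟶ H)
    {X Y X' : A} {x : F ⟶ (Functor.const J).obj X} {y : G ⟶ (Functor.const J).obj Y}
    {x' : H ⟶ (Functor.const J).obj X'} (hx : IsColimit (Cocone.mk X x))
    (hy : IsColimit (Cocone.mk Y y)) (hx' : IsColimit (Cocone.mk X' x')) {m : X ⟶ Y} {f : X ⟶ X'}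
    (hm : ∀ j, x.app j ≫ m = α.app j ≫ y.app j) (hf : ∀ j, x.app j ≫ f = β.app j ≫ x'.app j)
    (h : ∀ j, ∃ (Z : A) (c : G.obj j ⟶ Z) (d : H.obj j ⟶ Z),
      IsPushout (α.app j) (β.app j) c d ∧ factoring N d) :
    ∃ (Z : A) (c : Y ⟶ Z) (d : X' ⟶ Z), IsPushout m f c d ∧ factoring N d := by
  choose Z c d sq hd using h
  obtain ⟨K, γ, δ, sq'⟩ := exists_isPushout_app α β (fun j ↦ (sq j).hasPushout)
  let hK := colimit.isColimit K
  let c : Y ⟶ colimit K := hy.desc (Cocone.mk _ (γ ≫ (colimit.cocone K).ι))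
  let d : X' ⟶ colimit K := hx'.desc (Cocone.mk _ (δ ≫ (colimit.cocone K).ι))
  have hc (j : J) : y.app j ≫ c = γ.app j ≫ (colimit.cocone K).ι.app j :=
    hy.fac (Cocone.mk _ (γ ≫ (colimit.cocone K).ι)) j
  have hd' (j : J) : x'.app j ≫ d = δ.app j ≫ (colimit.cocone K).ι.app j :=
    hx'.fac (Cocone.mk _ (δ ≫ (colimit.cocone K).ι)) j
  exact ⟨colimit K, c, d, isPushout_of_isColimit sq' hx hy hx' hK hm hf hc hd',
    factoring_of_isColimit δ hx' hK hd'
      (fun j ↦ factoring_of_isPushout_of_isPushout (sq j) (sq' j) (hd j))⟩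

variable [IsCardinalAccessibleCategory A κ]

lemma exists_isPushout_of_hom (hN : IsQEMonoClass N) {P Q : Presentables A κ} {n : P ⟶ Q}
    (hn : N n) {X' : A} (f : P.obj ⟶ X') :
    ∃ (Z : A) (c : Q.obj ⟶ Z) (d : X' ⟶ Z), IsPushout n.hom f c d ∧ factoring N d := by
  obtain ⟨J, _, _, ⟨p⟩⟩ :=
    (isCardinalFilteredGenerator_isCardinalPresentable A κ).exists_colimitsOfShape X'
  have := isFiltered_of_isCardinalFiltered J κ
  -- As `P` is presentable, `f` factors through a stage `j₀`; past it, the pushouts are those of `n`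
  -- along morphisms of presentable objects.
  obtain ⟨j₀, f₀, rfl⟩ := IsCardinalPresentable.exists_hom_of_isColimit κ p.isColimit f
  have := HasCardinalFilteredColimits.hasColimitsOfShape A κ (Under j₀)
  have := isFiltered_of_isCardinalFiltered (Under j₀) κ
  have := IsFiltered.isConnected (Under j₀)
  refine exists_isPushout_of_isColimit (J := Under j₀) (F := (Functor.const _).obj P.obj)
    (G := (Functor.const _).obj Q.obj) (H := Under.forget j₀ ⋙ p.diag)
    ((Functor.const _).map n.hom)
    { app j := f₀ ≫ p.diag.map j.hom
      naturality i j g := by simp [← Functor.map_comp] }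
    (isColimitConstCocone _ _) (isColimitConstCocone _ _)
    ((Functor.Final.isColimitWhiskerEquiv (Under.forget j₀) _).symm p.isColimit)
    (fun j ↦ by simp) (fun j ↦ ?_) (fun j ↦ ?_)
  · have := p.ι.naturality j.hom
    dsimp at this
    simp [this]
  · let g : P ⟶ (⟨p.diag.obj j.right, p.prop_diag_obj _⟩ : Presentables A κ) :=
      ObjectProperty.homMk (f₀ ≫ p.diag.map j.hom)
    have := hN.hasPushout n g hn
    have sq := IsPushout.of_hasPushout n g
    exact ⟨_, _, _, isPushout_hom sq, factoring_hom (hN.of_isPushout sq hn)⟩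

lemma exists_isPushout (hN : IsQEMonoClass N) {X Y X' : A} {m : X ⟶ Y} (hm : factoring N m)
    (f : X ⟶ X') : ∃ (Z : A) (c : Y ⟶ Z) (d : X' ⟶ Z), IsPushout m f c d ∧ factoring N d := by
  obtain ⟨Ξ, _, _, F, G, φ, a, b, hF, hG, h₁, h₂⟩ :=
    exists_presentation (directedColimitClosure_of_factoring hm)
  have := isFiltered_of_isCardinalFiltered Ξ κ
  have := IsFiltered.isConnected Ξ
  have := HasCardinalFilteredColimits.hasColimitsOfShape A κ Ξ
  -- The third corner stays constant at `X'`, which is its own colimit because the index is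
  -- connected.
  exact exists_isPushout_of_isColimit (Functor.whiskerRight φ (isCardinalPresentable A κ).ι)
    (a ≫ (Functor.const Ξ).map f) hF hG (isColimitConstCocone _ _) h₁
    (fun j ↦ by simp) (fun j ↦ exists_isPushout_of_hom hN (h₂ j) _)

lemma factoring_comp (hN : IsQEMonoClass N) {X Y Z : A} {f : X ⟶ Y} {g : Y ⟶ Z}
    (hf : factoring N f) (hg : factoring N g) : factoring N (f ≫ g) := by
  intro P Q p a b hab
  obtain ⟨P₁, Q₁, n₁, s₁, t₁, a₁, b₁, hn₁, h₁, rfl, hb₁, h₂⟩ := hf (𝟙 P) a (a ≫ f) (by simp)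
  obtain ⟨R, i, j, r, hi, hj, hij⟩ := exists_commSq (s₁ ≫ n₁) p (b₁ ≫ g) b (by
    rw [← hab]
    simp [reassoc_of% h₂])
  obtain ⟨P₂, Q₂, n₂, s₂, t₂, a₂, b₂, hn₂, h₃, hs₂, ht₂, h₄⟩ := hg i b₁ r hi.symm
  obtain ⟨P₃, Q₃, n₃, s₃, t₃, a₃, b₃, hn₃, h₅, hs₃, ht₃, h₆⟩ := hf (n₁ ≫ s₂) a₁ a₂
    (by simp [hs₂, h₂])
  -- The members `n₃` over `f` and `n₂` over `g` are not composable: `t₃` goes from the source of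
  -- `n₂` to the target of `n₃`. Pushing `n₂` out along `t₃` makes them so.
  have := hN.hasPushout n₂ t₃ hn₂
  have sq := IsPushout.of_hasPushout n₂ t₃
  refine ⟨P₃, pushout n₂ t₃, n₃ ≫ pushout.inr _ _, s₁ ≫ s₃, j ≫ t₂ ≫ pushout.inl _ _, a₃,
    (isPushout_hom sq).desc b₂ (b₃ ≫ g) ?_, hN.comp_mem _ _ hn₃ (hN.of_isPushout sq hn₂),
    ?_, ?_, ?_, ?_⟩
  · rw [← reassoc_of% ht₃] at h₄
    rw [← h₄, reassoc_of% ht₃]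
  · have h₅' := h₅ =≫ pushout.inr n₂ t₃
    simp only [Category.assoc] at h₅' hij ⊢
    rw [h₅', ← sq.w, reassoc_of% h₃, reassoc_of% hij]
  · simp [hs₃]
  · simp [ht₂, hj]
  · simp [reassoc_of% h₆]

end Closure

/-! ### Fork-shaped diagrams -/

section ForkDiagrams

variable {C : Type u} [Category.{v} C]

namespace ForkShape

lemma forall_obj {P : ForkShape → Prop} (h₁ : P one) (h₂ : P two) (h₃ : P three) (i : ForkShape) :
    P i :=
  match i with
  | .star => h₁
  | .of .zero => h₂
  | .of .one => h₃

lemma forall_hom {P : ∀ ⦃i j : ForkShape⦄, (i ⟶ j) → Prop} (hid : ∀ i, P (𝟙 i))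
    (hm : P m) (h₁ : P k₁) (h₂ : P k₂) (h : P (m ≫ k₁)) : ∀ ⦃i j : ForkShape⦄ (f : i ⟶ j), P f
  | .star, .star, _ => hid _
  | .star, .of .zero, _ => hm
  | .star, .of .one, _ => h
  | .of _, .of _, WalkingParallelPairHom.left => h₁
  | .of _, .of _, WalkingParallelPairHom.right => h₂
  | .of _, .of _, WalkingParallelPairHom.id _ => hid _

end ForkShape

/-- A morphism of fork-shaped diagrams. -/
def forkHom {S T : ForkShape ⥤ C} (a : S.obj ForkShape.one ⟶ T.obj ForkShape.one)
    (b : S.obj ForkShape.two ⟶ T.obj ForkShape.two)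
    (c : S.obj ForkShape.three ⟶ T.obj ForkShape.three)
    (hm : S.map ForkShape.m ≫ b = a ≫ T.map ForkShape.m)
    (h₁ : S.map ForkShape.k₁ ≫ c = b ≫ T.map ForkShape.k₁)
    (h₂ : S.map ForkShape.k₂ ≫ c = b ≫ T.map ForkShape.k₂) : S ⟶ T where
  app
    | .star => a
    | .of .zero => b
    | .of .one => c
  naturality := ForkShape.forall_hom (fun _ ↦ by simp) hm h₁ h₂ (by
    rw [S.map_comp, T.map_comp, Category.assoc, ← reassoc_of% hm]
    exact congr_arg (fun f ↦ S.map ForkShape.m ≫ f) h₁)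

lemma forkHom_ext {S T : ForkShape ⥤ C} {f g : S ⟶ T}
    (h₁ : f.app ForkShape.one = g.app ForkShape.one)
    (h₂ : f.app ForkShape.two = g.app ForkShape.two)
    (h₃ : f.app ForkShape.three = g.app ForkShape.three) : f = g :=
  NatTrans.ext (funext (ForkShape.forall_obj h₁ h₂ h₃))

/-- The fork-shaped diagram `X ⟶ Y ⇉ Z`. -/
def forkDiagram {X Y Z : C} (m : X ⟶ Y) (k₁ k₂ : Y ⟶ Z) (h : m ≫ k₁ = m ≫ k₂) :
    ForkShape ⥤ C :=
  WithInitial.lift (parallelPair k₁ k₂)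
    (fun | .zero => m
         | .one => m ≫ k₁)
    (by rintro _ _ (_ | _ | _) <;> simp [h])

end ForkDiagrams

/-! ### Cokernel pairs, equalizers and coherence -/

section Closure

lemma IsQEMonoClass.mono {C : Type u} [Category.{v} C] {M : MorphismProperty C}
    (hM : IsQEMonoClass M) {X Y : C} {m : X ⟶ Y} (hm : M m) : Mono m := by
  have := hM.hasPushout m m hm
  exact Fork.IsLimit.mono (hM.isEqualizer hm (IsPushout.of_hasPushout m m)).some

variable {A : Type u} [Category.{v} A] {κ : Cardinal.{w}} [Fact κ.IsRegular]
  [IsCardinalAccessibleCategory A κ] {N : MorphismProperty (Presentables A κ)}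

lemma exists_cokernelPair_presentation (hN : IsQEMonoClass N) {X Y Z : A} {m : X ⟶ Y}
    {k₁ k₂ : Y ⟶ Z} (hm : factoring N m) (sq : IsPushout m m k₁ k₂) :
    ∃ (Ξ : Type w) (_ : PartialOrder Ξ) (_ : IsCardinalFiltered Ξ κ)
      (F G K : Ξ ⥤ Presentables A κ) (φ : F ⟶ G) (γ δ : G ⟶ K)
      (a : F ⋙ (isCardinalPresentable A κ).ι ⟶ (Functor.const Ξ).obj X)
      (b : G ⋙ (isCardinalPresentable A κ).ι ⟶ (Functor.const Ξ).obj Y)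
      (c : K ⋙ (isCardinalPresentable A κ).ι ⟶ (Functor.const Ξ).obj Z)
      (_ : IsColimit (Cocone.mk X a)) (_ : IsColimit (Cocone.mk Y b))
      (_ : IsColimit (Cocone.mk Z c)),
      (∀ j, a.app j ≫ m = (φ.app j).hom ≫ b.app j) ∧
        (∀ j, b.app j ≫ k₁ = (γ.app j).hom ≫ c.app j) ∧
        (∀ j, b.app j ≫ k₂ = (δ.app j).hom ≫ c.app j) ∧ (∀ j, N (φ.app j)) ∧
        ∀ j, IsPushout (φ.app j) (φ.app j) (γ.app j) (δ.app j) := by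
  obtain ⟨Ξ, _, _, F, G, φ, a, b, hF, hG, h₁, h₂⟩ :=
    exists_presentation (directedColimitClosure_of_factoring hm)
  have := HasCardinalFilteredColimits.hasColimitsOfShape A κ Ξ
  obtain ⟨K, γ, δ, sq'⟩ := exists_isPushout_app φ φ (fun j ↦ hN.hasPushout _ _ (h₂ j))
  let c := (colimit.cocone (K ⋙ (isCardinalPresentable A κ).ι)).ι
  let hK := colimit.isColimit (K ⋙ (isCardinalPresentable A κ).ι)
  let l₁ := hG.desc (Cocone.mk _ (Functor.whiskerRight γ (isCardinalPresentable A κ).ι ≫ c))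
  let l₂ := hG.desc (Cocone.mk _ (Functor.whiskerRight δ (isCardinalPresentable A κ).ι ≫ c))
  have hl₁ (j : Ξ) : b.app j ≫ l₁ = (γ.app j).hom ≫ c.app j := hG.fac _ j
  have hl₂ (j : Ξ) : b.app j ≫ l₂ = (δ.app j).hom ≫ c.app j := hG.fac _ j
  have sq'' : IsPushout m m l₁ l₂ := isPushout_of_isColimit
    (α := Functor.whiskerRight φ (isCardinalPresentable A κ).ι)
    (β := Functor.whiskerRight φ (isCardinalPresentable A κ).ι)
    (γ := Functor.whiskerRight γ (isCardinalPresentable A κ).ι)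
    (δ := Functor.whiskerRight δ (isCardinalPresentable A κ).ι)
    (fun j ↦ isPushout_hom (sq' j)) hF hG hG hK h₁ h₁ hl₁ hl₂
  -- The colimit of stagewise cokernel pairs is a cokernel pair of `m`, so it is identified with the
  -- given one.
  let e := sq''.isoIsPushout _ _ sq
  exact ⟨Ξ, inferInstance, inferInstance, F, G, K, φ, γ, δ, a, b,
    c ≫ (Functor.const Ξ).map e.hom, hF, hG, IsColimit.ofIsoColimit hK (Cocone.ext e),
    h₁, fun j ↦ by simp [← reassoc_of% (hl₁ j), e], fun j ↦ by simp [← reassoc_of% (hl₂ j), e],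
    h₂, sq'⟩

/-- Two morphisms from a presentable object that `m` identifies are already identified by a map `c`
of presentable objects over `m`; factoring `c` through a member of `N`, which is mono, identifies
them over `X`. -/
lemma mono_of_factoring (hN : IsQEMonoClass N) {X Y : A} {m : X ⟶ Y} (hm : factoring N m) :
    Mono m := by
  refine ⟨fun {T} s t hst ↦ hom_ext_of_presentable (κ := κ) fun P p ↦ ?_⟩
  obtain ⟨R, a, b, r, ha, hb⟩ := exists_common_factorization (p ≫ s) (p ≫ t)
  obtain ⟨R', c, r', hc, hab⟩ := exists_coequalizing a b (r ≫ m) (by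
    rw [reassoc_of% ha, reassoc_of% hb, hst])
  obtain ⟨P', Q', n, i, j, a', b', hn, h₁, h₂, h₃, h₄⟩ := hm c r r' hc.symm
  have := hN.mono hn
  have : a ≫ i = b ≫ i := by simp [← cancel_mono n, h₁, reassoc_of% hab]
  rw [← ha, ← hb, ← h₂]
  simpa using congr_arg (fun e ↦ e.hom ≫ a') this

lemma exists_lift_of_presentable (hN : IsQEMonoClass N) {X Y Z : A} {m : X ⟶ Y}
    {k₁ k₂ : Y ⟶ Z} (hm : factoring N m) (sq : IsPushout m m k₁ k₂) {P : Presentables A κ}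
    (t : P.obj ⟶ Y) (ht : t ≫ k₁ = t ≫ k₂) : ∃ s : P.obj ⟶ X, s ≫ m = t := by
  obtain ⟨Ξ, _, _, F, G, K, φ, γ, δ, a, b, c, hF, hG, hK, h₁, h₂, h₃, hφ, sq'⟩ :=
    exists_cokernelPair_presentation hN hm sq
  obtain ⟨j, t, rfl⟩ := IsCardinalPresentable.exists_hom_of_isColimit κ hG t
  obtain ⟨i, f, hf⟩ := IsCardinalPresentable.exists_eq_of_isColimit' κ hK
    (t ≫ (γ.app j).hom) (t ≫ (δ.app j).hom) (by simpa [h₂, h₃] using ht)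
  let t' : P ⟶ G.obj i := ObjectProperty.homMk (t ≫ (G.map f).hom)
  have ht' : t' ≫ γ.app i = t' ≫ δ.app i := by
    ext
    have h (η : G ⟶ K) := congr_arg InducedCategory.Hom.hom (η.naturality f)
    simp only [ObjectProperty.FullSubcategory.comp_hom] at h
    simpa [t', h] using hf
  -- At stage `i` the morphism equalizes the cokernel pair of `φ.app i`, so the equalizer property
  -- of `N` applies.
  let s := Fork.IsLimit.lift (hN.isEqualizer (hφ i) (sq' i)).some t' ht'
  have hs : s ≫ φ.app i = t' := Fork.IsLimit.lift_ι _
  refine ⟨s.hom ≫ a.app i, ?_⟩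
  have hs' := congr_arg InducedCategory.Hom.hom hs
  have hb := b.naturality f
  simp only [ObjectProperty.FullSubcategory.comp_hom] at hs'
  simp only [Functor.comp_map, ObjectProperty.ι_map, Functor.const_obj_map] at hb
  rw [Category.assoc, h₁, reassoc_of% hs']
  simp [t', hb]

lemma nonempty_isLimit_fork (hN : IsQEMonoClass N) {X Y Z : A} {m : X ⟶ Y}
    {k₁ k₂ : Y ⟶ Z} (hm : factoring N m) (sq : IsPushout m m k₁ k₂) :
    Nonempty (IsLimit (Fork.ofι m sq.w)) := by
  have := mono_of_factoring hN hm
  have h (s : Fork k₁ k₂) : ∃ l : s.pt ⟶ X, l ≫ m = s.ι := by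
    -- The lifts over presentable objects are chosen arbitrarily; they are compatible because `m` is
    -- mono.
    choose l hl using fun (P : PresentableOver κ s.pt) ↦
      exists_lift_of_presentable (P := P.left) hN hm sq (P.hom ≫ s.ι) (by simp [s.condition])
    let c : Cocone (CostructuredArrow.proj (isCardinalPresentable A κ).ι s.pt ⋙
        (isCardinalPresentable A κ).ι) :=
      { pt := X
        ι := { app := l
               naturality P Q f := (cancel_mono m).1 (by
                have h : f.left.hom ≫ Q.hom = P.hom := CostructuredArrow.w f
                have h' : (f.left.hom ≫ l Q) ≫ m = l P ≫ m := by
                  rw [Category.assoc, hl, reassoc_of% h, hl]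
                exact h'.trans (congr_arg (fun g ↦ g ≫ m) (Category.comp_id _).symm)) } }
    refine ⟨(isColimitCanonicalCocone κ s.pt).desc c, ?_⟩
    refine (isColimitCanonicalCocone κ s.pt).hom_ext fun P ↦ ?_
    have := (isColimitCanonicalCocone κ s.pt).fac c P
    exact (Category.assoc _ _ _).symm.trans ((congr_arg (fun g ↦ g ≫ m) this).trans (hl P))
  exact ⟨Fork.IsLimit.mk _ (fun s ↦ (h s).choose) (fun s ↦ (h s).choose_spec)
    (fun s l hl ↦ by
      rw [← cancel_mono m]
      exact hl.trans (h s).choose_spec.symm)⟩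

variable (N) in
lemma isQEMonoClass_directedColimitClosure (hN : IsQEMonoClass N) :
    IsQEMonoClass (directedColimitClosure κ N) := by
  rw [directedColimitClosure_eq_factoring]
  exact
    { hasPushout m f hm := by
        obtain ⟨Z, c, d, sq, -⟩ := exists_isPushout hN hm f
        exact sq.hasPushout
      of_isPushout {X Y X' Y' m f m' f'} sq hm := by
        obtain ⟨Z, c, d, sq', hd⟩ := exists_isPushout hN hm f
        exact factoring_of_isPushout_of_isPushout sq' sq hd
      isEqualizer hm sq := nonempty_isLimit_fork hN hm sq
      id_mem := factoring_id hN
      comp_mem f g hf hg := factoring_comp hN hf hg }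

lemma isLocallyCoherent_directedColimitClosure (hN : IsQEMonoClass N) :
    IsLocallyCoherent κ (directedColimitClosure κ N) := by
  rw [directedColimitClosure_eq_factoring]
  refine fun S ↦ ⟨fun ⟨hS, sq⟩ ↦ ?_, fun ⟨Ξ, _, _, ⟨p⟩⟩ ↦ ?_⟩
  · obtain ⟨Ξ, _, _, F, G, K, φ, γ, δ, a, b, c, hF, hG, hK, h₁, h₂, h₃, hφ, sq'⟩ :=
      exists_cokernelPair_presentation hN hS sq
    have hid (E : Ξ ⥤ Presentables A κ) (j : Ξ) : (E.map (𝟙 j)).hom = 𝟙 (E.obj j).obj :=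
      congr_arg InducedCategory.Hom.hom (E.map_id j)
    let D : Ξ ⥤ ForkShape ⥤ A :=
      { obj j := forkDiagram (φ.app j).hom (γ.app j).hom (δ.app j).hom (isPushout_hom (sq' j)).w
        map {i j} f := forkHom (F.map f).hom (G.map f).hom (K.map f).hom
          (congr_arg InducedCategory.Hom.hom (φ.naturality f).symm)
          (congr_arg InducedCategory.Hom.hom (γ.naturality f).symm)
          (congr_arg InducedCategory.Hom.hom (δ.naturality f).symm)
        map_id j := forkHom_ext (hid F j)
          (hid G j)
          (hid K j)
        map_comp f g := forkHom_ext (congr_arg InducedCategory.Hom.hom (F.map_comp f g))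
          (congr_arg InducedCategory.Hom.hom (G.map_comp f g))
          (congr_arg InducedCategory.Hom.hom (K.map_comp f g)) }
    let s : D ⟶ (Functor.const Ξ).obj S :=
      { app j := forkHom (a.app j) (b.app j) (c.app j) (h₁ j).symm (h₂ j).symm (h₃ j).symm
        naturality i j f := forkHom_ext (a.naturality f) (b.naturality f) (c.naturality f) }
    exact ⟨Ξ, inferInstance, inferInstance, ⟨{
      diag := D
      ι := s
      isColimit := evaluationJointlyReflectsColimits _ (fun
        | .star => hF
        | .of .zero => hG
        | .of .one => hK)
      prop_diag_obj j := ⟨⟨factoring_hom (hφ j), isPushout_hom (sq' j)⟩,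
        ForkShape.forall_obj (F.obj j).property (G.obj j).property (K.obj j).property⟩ }⟩⟩
  -- Existence of these colimits makes evaluation preserve them, so `p` is a colimit at each of the
  -- three terms.
  · have := HasCardinalFilteredColimits.hasColimitsOfShape A κ Ξ
    have hS (i : ForkShape) := isColimitOfPreserves ((evaluation _ A).obj i) p.isColimit
    have hp (j : Ξ) := (p.prop_diag_obj j).1
    let ev {i i' : ForkShape} (f : i ⟶ i') := Functor.whiskerLeft p.diag ((evaluation _ A).map f)
    have hι {i i' : ForkShape} (f : i ⟶ i') (j : Ξ) :
        (p.ι.app j).app i ≫ S.map f = (p.diag.obj j).map f ≫ (p.ι.app j).app i' :=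
      ((p.ι.app j).naturality f).symm
    exact ⟨factoring_of_isColimit (ev ForkShape.m) (hS _) (hS _) (hι _) (fun j ↦ (hp j).1),
      isPushout_of_isColimit (α := ev ForkShape.m) (β := ev ForkShape.m) (γ := ev ForkShape.k₁)
        (δ := ev ForkShape.k₂) (fun j ↦ (hp j).2) (hS _) (hS _) (hS _) (hS _)
        (hι _) (hι _) (hι _) (hι _)⟩

end Closure

end QEMono

theorem theorem7p1 {A : Type u} [Category.{v} A] (κ : Cardinal.{w}) [Fact κ.IsRegular]
    [IsCardinalAccessibleCategory A κ]
    (N : MorphismProperty (QEMono.Presentables A κ)) (hN : QEMono.IsQEMonoClass N) :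
    QEMono.IsQEMonoClass (QEMono.directedColimitClosure κ N) ∧
      QEMono.IsLocallyCoherent κ (QEMono.directedColimitClosure κ N) :=
  ⟨QEMono.isQEMonoClass_directedColimitClosure N hN,
    QEMono.isLocallyCoherent_directedColimitClosure hN⟩
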